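/- Let $A$ be a real or complex Banach algebra (not assumed unital) with a bounded two-sided approximate identity, that is, a bounded net $(e_\alpha)$ in $A$ with $e_\alpha a \to a$ and $a e_\alpha \to a$ in norm for every $a \in A$. Equip the bidual $A^{**}$ with the first Arens product: for $a,b\in A$, $f\in A^*$ and $F,G\in A^{**}$, \[ \langle fa, b\rangle = \langle f, ab\rangle,\qquad \langle Ff, a\rangle = \langle F, fa\rangle,\qquad \langle GF, f\rangle = \langle G, Ff\rangle. \] For an algebra $B$, let $\mathrm{Soc}(B)$ denote its left socle, i.e. the smallest left ideal of $B$ containing all minimal left ideals of $B$ (and $\mathrm{Soc}(B)=(0)$ if $B$ has no minimal left ideals); here left ideals are linear subspaces stable under left multiplication, and a minimal left ideal is a nonzero left ideal that properly contains no nonzero left ideal. If $\mathrm{Soc}(A^{**}) = A^{**}$, then $A$ is finite dimensional. -/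

import Mathlib

open Filter Topology

noncomputable section

section ArensProduct

variable (𝕜 : Type*) [RCLike 𝕜] (A : Type*) [NonUnitalNormedRing A] [NormedSpace 𝕜 A]
  [IsScalarTower 𝕜 A A] [SMulCommClass 𝕜 A A]

/-- The map `f ↦ (a ↦ f a)`, where `f a` is the functional `⟨f a, b⟩ = ⟨f, a b⟩`. -/
def dualAct : StrongDual 𝕜 A →L[𝕜] (A →L[𝕜] StrongDual 𝕜 A) :=
  ((ContinuousLinearMap.compL 𝕜 A (A →L[𝕜] A) (StrongDual 𝕜 A)).flip
    (ContinuousLinearMap.mul 𝕜 A)) ∘L (ContinuousLinearMap.compL 𝕜 A A 𝕜)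

theorem dualAct_apply (f : StrongDual 𝕜 A) (a b : A) : dualAct 𝕜 A f a b = f (a * b) := rfl

/-- The map `f ↦ F f`, where `F f` is the functional `⟨F f, a⟩ = ⟨F, f a⟩`. -/
def bidualAct (F : StrongDual 𝕜 (StrongDual 𝕜 A)) : StrongDual 𝕜 A →L[𝕜] StrongDual 𝕜 A :=
  (ContinuousLinearMap.compL 𝕜 A (StrongDual 𝕜 A) 𝕜 F) ∘L (dualAct 𝕜 A)

theorem bidualAct_apply (F : StrongDual 𝕜 (StrongDual 𝕜 A)) (f : StrongDual 𝕜 A) (a : A) :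
    bidualAct 𝕜 A F f a = F (dualAct 𝕜 A f a) := rfl

/-- The bidual `A**` of a normed algebra `A`, with its usual Banach space structure; it is a type
of its own so that it can carry the first Arens product as its multiplication. -/
def Bidual : Type _ := StrongDual 𝕜 (StrongDual 𝕜 A)

namespace Bidual

instance : NormedAddCommGroup (Bidual 𝕜 A) :=
  inferInstanceAs (NormedAddCommGroup (StrongDual 𝕜 (StrongDual 𝕜 A)))

instance : NormedSpace 𝕜 (Bidual 𝕜 A) :=
  inferInstanceAs (NormedSpace 𝕜 (StrongDual 𝕜 (StrongDual 𝕜 A)))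

instance : CompleteSpace (Bidual 𝕜 A) :=
  inferInstanceAs (CompleteSpace (StrongDual 𝕜 (StrongDual 𝕜 A)))

variable {𝕜 A}

/-- An element of the bidual as a functional on the dual. -/
def toFunctional (F : Bidual 𝕜 A) : StrongDual 𝕜 (StrongDual 𝕜 A) := F

/-- The first Arens product: `⟨G F, f⟩ = ⟨G, F f⟩`. -/
def arensMul (G F : Bidual 𝕜 A) : Bidual 𝕜 A :=
  (G.toFunctional ∘L bidualAct 𝕜 A F.toFunctional : StrongDual 𝕜 (StrongDual 𝕜 A))

instance : Mul (Bidual 𝕜 A) := ⟨arensMul⟩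

theorem mul_toFunctional_apply (G F : Bidual 𝕜 A) (f : StrongDual 𝕜 A) :
    (G * F).toFunctional f = G.toFunctional (bidualAct 𝕜 A F.toFunctional f) := rfl

theorem ext_toFunctional {F G : Bidual 𝕜 A} (h : ∀ f, F.toFunctional f = G.toFunctional f) :
    F = G :=
  ContinuousLinearMap.ext (f := F.toFunctional) (g := G.toFunctional) h

theorem norm_bidualAct_apply_le (F : Bidual 𝕜 A) (f : StrongDual 𝕜 A) :
    ‖bidualAct 𝕜 A F.toFunctional f‖ ≤ ‖F‖ * ‖f‖ := by
  refine ContinuousLinearMap.opNorm_le_bound _ (by positivity) fun a => ?_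
  have h1 : ‖dualAct 𝕜 A f a‖ ≤ ‖f‖ * ‖a‖ := by
    refine ContinuousLinearMap.opNorm_le_bound _ (by positivity) fun b => ?_
    calc ‖f (a * b)‖ ≤ ‖f‖ * ‖a * b‖ := f.le_opNorm _
      _ ≤ ‖f‖ * (‖a‖ * ‖b‖) := by gcongr; exact norm_mul_le a b
      _ = ‖f‖ * ‖a‖ * ‖b‖ := by ring
  calc ‖F.toFunctional (dualAct 𝕜 A f a)‖ ≤ ‖F‖ * ‖dualAct 𝕜 A f a‖ :=
        F.toFunctional.le_opNorm _
    _ ≤ ‖F‖ * (‖f‖ * ‖a‖) := by gcongr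
    _ = ‖F‖ * ‖f‖ * ‖a‖ := by ring

/-- The bidual with the first Arens product is a Banach algebra (not necessarily unital). -/
instance : NonUnitalNormedRing (Bidual 𝕜 A) :=
  { (inferInstance : NormedAddCommGroup (Bidual 𝕜 A)) with
    mul := (· * ·)
    left_distrib := fun G F H => ext_toFunctional fun f =>
      G.toFunctional.map_add (bidualAct 𝕜 A F.toFunctional f) (bidualAct 𝕜 A H.toFunctional f)
    right_distrib := fun _ _ _ => rfl
    zero_mul := fun _ => rfl
    mul_zero := fun G => ext_toFunctional fun _ => G.toFunctional.map_zero
    mul_assoc := fun G F H => ext_toFunctional fun f => by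
      change G.toFunctional (bidualAct 𝕜 A F.toFunctional (bidualAct 𝕜 A H.toFunctional f)) =
        G.toFunctional (bidualAct 𝕜 A (F * H).toFunctional f)
      congr 1
      ext a
      change F.toFunctional _ = F.toFunctional (bidualAct 𝕜 A H.toFunctional (dualAct 𝕜 A f a))
      congr 1
      ext b
      change H.toFunctional _ = H.toFunctional _
      congr 1
      ext c
      change f (a * b * c) = f (a * (b * c))
      rw [mul_assoc]
    norm_mul_le := fun G F => by
      refine ContinuousLinearMap.opNorm_le_bound (G * F).toFunctional (by positivity) fun f => ?_
      calc ‖G.toFunctional (bidualAct 𝕜 A F.toFunctional f)‖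
          ≤ ‖G‖ * ‖bidualAct 𝕜 A F.toFunctional f‖ := G.toFunctional.le_opNorm _
        _ ≤ ‖G‖ * (‖F‖ * ‖f‖) := by gcongr; exact norm_bidualAct_apply_le F f
        _ = ‖G‖ * ‖F‖ * ‖f‖ := by ring }

instance : IsScalarTower 𝕜 (Bidual 𝕜 A) (Bidual 𝕜 A) := ⟨fun _ _ _ => rfl⟩

instance : SMulCommClass 𝕜 (Bidual 𝕜 A) (Bidual 𝕜 A) :=
  ⟨fun c G F => ext_toFunctional fun f =>
    (G.toFunctional.map_smul c (bidualAct 𝕜 A F.toFunctional f)).symm⟩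

end Bidual

end ArensProduct

section Socle

variable {𝕜 : Type*} [RCLike 𝕜] {B : Type*} [NonUnitalRing B] [Module 𝕜 B]

/-- A left ideal of an algebra: a linear subspace stable under left multiplication. -/
def IsLeftIdeal (I : Submodule 𝕜 B) : Prop :=
  ∀ x : B, ∀ y ∈ I, x * y ∈ I

/-- A minimal left ideal: a nonzero left ideal containing no other nonzero left ideal. -/
def IsMinimalLeftIdeal (I : Submodule 𝕜 B) : Prop :=
  IsLeftIdeal I ∧ I ≠ ⊥ ∧ ∀ J : Submodule 𝕜 B, IsLeftIdeal J → J ≤ I → J ≠ ⊥ → J = I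

variable (𝕜 B) in
/-- The left socle: the smallest left ideal containing all minimal left ideals
(it is `0` if there are none). -/
def leftSocle : Submodule 𝕜 B :=
  sInf {J | IsLeftIdeal J ∧ ∀ I : Submodule 𝕜 B, IsMinimalLeftIdeal I → I ≤ J}

end Socle

/-- `A` has a bounded (two-sided) approximate identity, expressed through filters. -/
def HasBoundedApproximateIdentity (A : Type*) [NonUnitalNormedRing A] : Prop :=
  ∃ l : Filter A, l.IsApproximateUnit ∧ ∃ C : ℝ, ∀ᶠ e in l, ‖e‖ ≤ C

end

/-!
Write `B = A**`. A weak-* cluster point `E` of the bounded approximate identity is a right identity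
of `B` (`Bidual.exists_forall_mul_eq`), and this is all that is used about the bidual: any normed
algebra `B` with a right identity `e` and `Soc(B) = B` is finite dimensional
(`finiteDimensional_of_leftSocle_eq_top`).

The element `e` is idempotent, `B = eB + R` with `R = {r | e r = 0}`, and `eB = eBe` is a unital
algebra.

* Right multiplication by an element of `R` is zero: `B R = 0`. As `e` lies in a sum of finitely many minimal left
  ideals `L`, and `r = r e` for `r ∈ R`, the space `R` lies in the sum of those `L` that are
  contained in `R`. On such an `L` left multiplication is zero, so that every subspace of it is a left ideal and
  minimality forces `dim L = 1`. Hence `R` is finite dimensional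
  (`finiteDimensional_ker_mulLeft`).
* For a minimal left ideal `L` the left ideal `eL` of `eBe` is zero or simple, so `eBe` is a
  semisimple ring (`isSemisimpleRing_corner`). By Wedderburn–Artin it is a finite product of matrix
  algebras over division algebras, each of which embeds into `B` and so carries a submultiplicative
  norm. The Gelfand–Mazur theorem (`finiteDimensional_of_divisionRing`) makes them, and hence
  `eBe`, finite dimensional.

Gelfand–Mazur is needed over `ℝ` too, for possibly noncommutative division algebras `D`. Here a
nonempty spectrum in an auxiliary complex Banach algebra shows that every element of `D` is a root
of a real quadratic polynomial `(X - a)² + b²` (`exists_not_isUnit_sq_add_sq`), after which the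
argument of Frobenius bounds the dimension by four (`finiteDimensional_of_forall_quadratic`).
-/

/-! ### The Gelfand–Mazur theorem for normed division algebras -/

/-- Under a ring homomorphism from a real to a complex algebra that is compatible with the real
scalars, `(x - Re z)² + (Im z)²` maps to the product of the commuting elements `z - T x` and
`conj z - T x`; if the former is invertible, so are both factors. -/
theorem not_mem_spectrum_of_isUnit_sq_add_sq {D S : Type*} [Ring D] [Algebra ℝ D] [Ring S]
    [Algebra ℂ S] (T : D →+* S) (hT : ∀ c : ℝ, T (algebraMap ℝ D c) = algebraMap ℂ S c)
    {x : D} {z : ℂ}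
    (hu : IsUnit ((x - algebraMap ℝ D z.re) ^ 2 + algebraMap ℝ D (z.im ^ 2))) :
    z ∉ spectrum ℂ (T x) := by
  have hzx := Algebra.commutes (starRingEnd ℂ z) (T x)
  have hre : algebraMap ℂ S z.re * T x = T x * algebraMap ℂ S z.re := Algebra.commutes _ _
  have hmul : algebraMap ℂ S z * algebraMap ℂ S (starRingEnd ℂ z) =
      algebraMap ℂ S z.re ^ 2 + algebraMap ℂ S (z.im ^ 2 : ℝ) := by
    rw [← map_mul, ← map_pow, ← map_add, Complex.mul_conj, Complex.normSq_apply,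
      ← Complex.ofReal_pow, ← Complex.ofReal_add, sq, sq]
  have hadd : algebraMap ℂ S z + algebraMap ℂ S (starRingEnd ℂ z) =
      algebraMap ℂ S z.re + algebraMap ℂ S z.re := by
    rw [← map_add, ← map_add, Complex.add_conj, ← Complex.ofReal_add, two_mul]
  have hfac : T ((x - algebraMap ℝ D z.re) ^ 2 + algebraMap ℝ D (z.im ^ 2)) =
      (algebraMap ℂ S z - T x) * (algebraMap ℂ S (starRingEnd ℂ z) - T x) := by
    calc _ = (T x - algebraMap ℂ S z.re) ^ 2 + algebraMap ℂ S (z.im ^ 2 : ℝ) := by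
          rw [map_add, map_pow, map_sub, hT, hT]
      _ = T x ^ 2 - (algebraMap ℂ S z.re + algebraMap ℂ S z.re) * T x +
          (algebraMap ℂ S z.re ^ 2 + algebraMap ℂ S (z.im ^ 2 : ℝ)) := by
          rw [sq (T x - _), sub_mul, mul_sub, mul_sub, ← hre]
          noncomm_ring
      _ = _ := by
          rw [← hadd, ← hmul, sub_mul, mul_sub, mul_sub, ← hzx]
          noncomm_ring
  have hcomm : Commute (algebraMap ℂ S z - T x) (algebraMap ℂ S (starRingEnd ℂ z) - T x) :=
    Commute.sub_left (Algebra.commutes z _)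
      (Commute.sub_right (Algebra.commutes _ (T x)).symm (Commute.refl _))
  have h := hu.map T
  rw [hfac] at h
  exact fun hz => hz (hcomm.isUnit_mul_iff.1 h).1

/-- The action of a real normed algebra `D` on the complex Banach space of bounded real-linear
maps `D → ℂ`, given by `(x • φ) d = φ (d x)`; it is by complex-linear operators, since the complex
scalars act on the values of `φ`. -/
noncomputable def dualRepresentation (D : Type*) [NormedRing D] [NormedAlgebra ℝ D] :
    D →+* ((D →L[ℝ] ℂ) →L[ℂ] (D →L[ℝ] ℂ)) where
  toFun x :=
    { toFun := fun φ => φ ∘L (ContinuousLinearMap.mul ℝ D).flip x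
      map_add' := fun _ _ => rfl
      map_smul' := fun _ _ => rfl
      cont := ((ContinuousLinearMap.compL ℝ D D ℂ).flip
        ((ContinuousLinearMap.mul ℝ D).flip x)).continuous }
  map_one' := by ext φ d; exact congrArg φ (mul_one d)
  map_mul' x y := by ext φ d; exact congrArg φ (mul_assoc d x y).symm
  map_zero' := by ext φ d; exact (congrArg φ (mul_zero d)).trans φ.map_zero
  map_add' x y := by ext φ d; exact (congrArg φ (mul_add d x y)).trans (φ.map_add _ _)

theorem exists_not_isUnit_of_representation {D E : Type*} [Ring D] [Algebra ℝ D]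
    [NormedAddCommGroup E] [NormedSpace ℂ E] [CompleteSpace E] [Nontrivial E]
    (T : D →+* (E →L[ℂ] E)) (hT : ∀ (c : ℝ) (v : E), T (algebraMap ℝ D c) v = (c : ℂ) • v) (x : D) :
    ∃ a b : ℝ, ¬ IsUnit ((x - algebraMap ℝ D a) ^ 2 + algebraMap ℝ D (b ^ 2)) := by
  obtain ⟨z, hz⟩ := spectrum.nonempty (T x)
  exact ⟨z.re, z.im, fun hu =>
    not_mem_spectrum_of_isUnit_sq_add_sq T (fun c => ContinuousLinearMap.ext (hT c)) hu hz⟩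

/-- The real substitute for the spectrum being nonempty. Completeness of `D` is not needed, because
the spectrum is taken in the operators on the dual-like space `D →L[ℝ] ℂ`, which is complete. -/
theorem exists_not_isUnit_sq_add_sq {D : Type*} [NormedRing D] [NormedAlgebra ℝ D] [Nontrivial D]
    (x : D) :
    ∃ a b : ℝ, ¬ IsUnit ((x - algebraMap ℝ D a) ^ 2 + algebraMap ℝ D (b ^ 2)) := by
  have : Nontrivial (D →L[ℝ] ℂ) := by
    obtain ⟨f, hf⟩ := exists_ne (0 : StrongDual ℝ D)
    refine ⟨Complex.ofRealCLM ∘L f, 0, fun h => hf ?_⟩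
    ext d
    exact Complex.ofReal_injective (congrArg (fun φ : D →L[ℝ] ℂ => φ d) h)
  refine exists_not_isUnit_of_representation (dualRepresentation D) (fun c φ => ?_) x
  ext d
  change φ (d * algebraMap ℝ D c) = (c : ℂ) * φ d
  rw [← Algebra.commutes, ← Algebra.smul_def, map_smul, Complex.real_smul]

/-- Frobenius' argument: an element `i` with `i² = -1` splits `D` into its centralizer, which is
`ℝ + ℝ i`, and the elements anticommuting with `i`. Right multiplication by a fixed nonzero
anticommuting `j` maps the latter injectively into the centralizer. -/
theorem finiteDimensional_of_forall_quadratic {D : Type*} [DivisionRing D] [Algebra ℝ D]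
    (h : ∀ x : D, ∃ a b : ℝ, (x - algebraMap ℝ D a) ^ 2 + algebraMap ℝ D (b ^ 2) = 0) :
    FiniteDimensional ℝ D := by
  have key (s : Set D) (hs : s.Finite) (hx : ∀ x, x ∈ Submodule.span ℝ s) :
      FiniteDimensional ℝ D :=
    ⟨Submodule.fg_def.2 ⟨s, hs, eq_top_iff.2 fun x _ => hx x⟩⟩
  by_cases hR : ∀ x : D, ∃ a : ℝ, x = algebraMap ℝ D a
  · refine key {1} (by simp) fun x => ?_
    obtain ⟨a, rfl⟩ := hR x
    exact Submodule.mem_span_singleton.2 ⟨a, (Algebra.algebraMap_eq_smul_one a).symm⟩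
  push Not at hR
  obtain ⟨i, hi⟩ : ∃ i : D, i * i = -1 := by
    obtain ⟨x, hx⟩ := hR
    obtain ⟨a, b, hab⟩ := h x
    have hb : b ≠ 0 := by
      rintro rfl
      exact hx a (sub_eq_zero.1 (by simpa using hab))
    refine ⟨b⁻¹ • (x - algebraMap ℝ D a), ?_⟩
    rw [smul_mul_smul_comm, ← sq (x - _), eq_neg_of_add_eq_zero_left hab,
      Algebra.algebraMap_eq_smul_one, smul_neg, smul_smul]
    rw [show b⁻¹ * b⁻¹ * b ^ 2 = 1 by field_simp, one_smul]
  -- If `y = a + w` commutes with `i` and `w² = -b²`, then `(w - b i) (w + b i) = 0`.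
  have hcent (y : D) (hy : i * y = y * i) : ∃ p q : ℝ, y = p • 1 + q • i := by
    obtain ⟨a, b, hab⟩ := h y
    set w := y - algebraMap ℝ D a with hw
    have hwi : w * i = i * w := by
      rw [hw, sub_mul, mul_sub, hy, Algebra.commutes]
    have hprod : (w - b • i) * (w + b • i) = 0 := by
      rw [sub_mul, mul_add, mul_add, smul_mul_smul_comm, hi, mul_smul_comm, smul_mul_assoc, hwi,
        ← hab, Algebra.algebraMap_eq_smul_one, sq w, sq b, smul_neg]
      abel
    have hy' : y = a • 1 + w := by rw [hw, Algebra.algebraMap_eq_smul_one]; abel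
    rcases mul_eq_zero.1 hprod with h0 | h0
    · exact ⟨a, b, by rw [hy', sub_eq_zero.1 h0]⟩
    · exact ⟨a, -b, by rw [hy', eq_neg_of_add_eq_zero_left h0, neg_smul]⟩
  -- The commuting and the anticommuting part of `y`.
  have hsplit (y : D) : y = (2⁻¹ : ℝ) • (y - i * y * i) + (2⁻¹ : ℝ) • (y + i * y * i) := by
    rw [← smul_add, sub_add_add_cancel, ← two_smul ℝ y, smul_smul]
    norm_num
  have hii (y : D) : i * (i * y) = -y := by rw [← mul_assoc, hi, neg_one_mul]
  have hii' (y : D) : y * i * i = -y := by rw [mul_assoc, hi, mul_neg_one]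
  have hplus (y : D) : i * (y - i * y * i) = (y - i * y * i) * i := by
    rw [mul_sub, sub_mul, hii', mul_assoc, hii]
    noncomm_ring
  have hminus (y : D) : i * (y + i * y * i) = -((y + i * y * i) * i) := by
    rw [mul_add, add_mul, hii', mul_assoc, hii]
    abel
  by_cases hj : ∃ j : D, j ≠ 0 ∧ i * j = -(j * i)
  · obtain ⟨j, hj0, hj⟩ := hj
    refine key {1, i, j⁻¹, i * j⁻¹} (by simp) fun y => ?_
    obtain ⟨p, q, hpq⟩ := hcent _ (hplus y)
    obtain ⟨r, s, hrs⟩ := hcent ((y + i * y * i) * j) (by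
      rw [← mul_assoc, hminus, mul_assoc _ j i, neg_mul, mul_assoc, hj, mul_neg, neg_neg])
    have hrs' : y + i * y * i = r • j⁻¹ + s • (i * j⁻¹) := by
      rw [← mul_inv_cancel_right₀ hj0 (y + i * y * i), hrs, add_mul, smul_mul_assoc,
        smul_mul_assoc, one_mul]
    rw [hsplit y, hpq, hrs']
    have hm {z : D} (hz : z ∈ ({1, i, j⁻¹, i * j⁻¹} : Set D)) (c : ℝ) :
        c • z ∈ Submodule.span ℝ ({1, i, j⁻¹, i * j⁻¹} : Set D) :=
      Submodule.smul_mem _ _ (Submodule.subset_span hz)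
    exact add_mem (Submodule.smul_mem _ _ (add_mem (hm (by simp) _) (hm (by simp) _)))
      (Submodule.smul_mem _ _ (add_mem (hm (by simp) _) (hm (by simp) _)))
  · push Not at hj
    refine key {1, i} (by simp) fun y => ?_
    obtain ⟨p, q, hpq⟩ := hcent _ (hplus y)
    have h0 : y + i * y * i = 0 := by
      by_contra h0
      exact hj _ h0 (hminus y)
    rw [hsplit y, hpq, h0, smul_zero, add_zero]
    exact Submodule.smul_mem _ _ (Submodule.mem_span_pair.2 ⟨p, q, rfl⟩)

/-- **Gelfand–Mazur**, in the form needed here: the norm on the division algebra `D` is the one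
induced by an embedding into a normed algebra, which is not assumed to be unital or complete. -/
theorem finiteDimensional_of_divisionRing {𝕜 : Type*} [RCLike 𝕜] {D B : Type*} [DivisionRing D]
    [Algebra 𝕜 D] [NonUnitalNormedRing B] [NormedSpace 𝕜 B] (φ : D →ₙₐ[𝕜] B)
    (hφ : Function.Injective φ) : FiniteDimensional 𝕜 D := by
  let _ : Algebra ℝ D := Algebra.compHom D (algebraMap ℝ 𝕜)
  have : IsScalarTower ℝ 𝕜 D := IsScalarTower.of_algebraMap_eq fun _ => rfl
  let _ : NormedRing D :=
    { NonUnitalNormedRing.induced D B φ hφ, (inferInstance : Ring D) with }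
  let _ : NormedAlgebra ℝ D :=
    { norm_smul_le := fun r x => by
        have h : φ (r • x) = (algebraMap ℝ 𝕜 r) • φ x := by
          rw [← map_smul, algebraMap_smul]
        change ‖φ (r • x)‖ ≤ ‖r‖ * ‖φ x‖
        rw [h, norm_smul, norm_algebraMap'] }
  have : FiniteDimensional ℝ D := finiteDimensional_of_forall_quadratic fun x => by
    obtain ⟨a, b, hab⟩ := exists_not_isUnit_sq_add_sq x
    exact ⟨a, b, by simpa [isUnit_iff_ne_zero] using hab⟩
  exact Module.Finite.of_restrictScalars_finite ℝ 𝕜 D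

/-! ### The corner `e B e` as an algebra -/

namespace IsIdempotentElem.Corner

variable {𝕜 B : Type*} [CommRing 𝕜] [NonUnitalRing B] [Module 𝕜 B] [IsScalarTower 𝕜 B B]
  [SMulCommClass 𝕜 B B] {e : B} (he : IsIdempotentElem e)

instance instModule : Module 𝕜 he.Corner where
  smul c u := ⟨c • u.1, c • u.1, by
    have h := (Subsemigroup.mem_corner_iff he).1 u.2
    simp only [mul_smul_comm, smul_mul_assoc, h.1, h.2]⟩
  one_smul _ := Subtype.ext (one_smul 𝕜 _)
  mul_smul _ _ _ := Subtype.ext (mul_smul _ _ _)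
  smul_zero _ := Subtype.ext (smul_zero _)
  smul_add _ _ _ := Subtype.ext (smul_add _ _ _)
  add_smul _ _ _ := Subtype.ext (add_smul _ _ _)
  zero_smul _ := Subtype.ext (zero_smul _ _)

instance instAlgebra : Algebra 𝕜 he.Corner :=
  Algebra.ofModule (fun c u v => Subtype.ext (smul_mul_assoc c u.1 v.1))
    (fun c u v => Subtype.ext (mul_smul_comm c u.1 v.1))

variable (𝕜) in
/-- The inclusion of the corner `e B e` into `B`; it is not unital, as `B` need not be. -/
def incl : he.Corner →ₙₐ[𝕜] B where
  toFun u := u.1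
  map_smul' _ _ := rfl
  map_zero' := rfl
  map_add' _ _ := rfl
  map_mul' _ _ := rfl

variable (𝕜) in
/-- The projection `x ↦ e x` of `B` onto the corner `e B e`, which equals `e B` when `e` is a right
identity. -/
def proj (h : ∀ x, x * e = x) : B →ₗ[𝕜] he.Corner where
  toFun x := ⟨e * x, x, by simp only [h]⟩
  map_add' _ _ := Subtype.ext (mul_add _ _ _)
  map_smul' c x := Subtype.ext (mul_smul_comm c e x)

end IsIdempotentElem.Corner

/-! ### Algebras with a right identity that equal their left socle -/

open IsIdempotentElem

section

variable {𝕜 B : Type*} [RCLike 𝕜] [NonUnitalRing B] [Module 𝕜 B] [IsScalarTower 𝕜 B B]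
  [SMulCommClass 𝕜 B B] {e : B}

omit [IsScalarTower 𝕜 B B] in
variable (𝕜 B) in
theorem leftSocle_le_sSup :
    leftSocle 𝕜 B ≤ sSup {I : Submodule 𝕜 B | IsMinimalLeftIdeal I} := by
  refine sInf_le ⟨fun x y hy => ?_, fun I hI => le_sSup hI⟩
  suffices h : sSup {I : Submodule 𝕜 B | IsMinimalLeftIdeal I} ≤
      (sSup {I : Submodule 𝕜 B | IsMinimalLeftIdeal I}).comap (LinearMap.mulLeft 𝕜 x) from h hy
  exact sSup_le fun I hI z hz => (le_sSup hI : I ≤ _) (hI.1 x z hz)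

omit [IsScalarTower 𝕜 B B] in
theorem finiteDimensional_ker_mulLeft (h : ∀ x, x * e = x) (hsoc : leftSocle 𝕜 B = ⊤) :
    FiniteDimensional 𝕜 (LinearMap.ker (LinearMap.mulLeft 𝕜 e)) := by
  set R := LinearMap.ker (LinearMap.mulLeft 𝕜 e) with hR
  -- `B R = 0`, as `x r = (x e) r = x (e r)`.
  have hzero {r : B} (hr : r ∈ R) (x : B) : x * r = 0 := by
    have hr : e * r = 0 := hr
    rw [← h x, mul_assoc, hr, mul_zero]
  have he : e ∈ sSup {I : Submodule 𝕜 B | IsMinimalLeftIdeal I} :=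
    leftSocle_le_sSup 𝕜 B (hsoc ▸ Submodule.mem_top)
  obtain ⟨s, hs, hes⟩ := Submodule.mem_sSup_iff_exists_finset.1 he
  classical
  -- Of the finitely many minimal left ideals whose sum contains `e`, those inside `R` are
  -- one-dimensional; `W` is their sum.
  set W : Submodule 𝕜 B := (s.filter (· ≤ R)).sup id with hW
  have hfin : FiniteDimensional 𝕜 W := by
    rw [hW, Finset.sup_eq_iSup]
    refine Module.Finite.iff_fg.2 (Submodule.fg_biSup _ _ fun I hI => ?_)
    obtain ⟨hIs, hIR⟩ := Finset.mem_filter.1 hI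
    obtain ⟨-, hne, hmin⟩ := hs hIs
    obtain ⟨y, hy, hy0⟩ := Submodule.exists_mem_ne_zero_of_ne_bot hne
    have hspan : Submodule.span 𝕜 {y} ≤ I := (Submodule.span_singleton_le_iff_mem _ _).2 hy
    rw [id, ← hmin (Submodule.span 𝕜 {y}) (fun x z hz => by
      rw [hzero (hIR (hspan hz))]; exact zero_mem _) hspan (by simpa using hy0)]
    exact Submodule.fg_span_singleton y
  refine Submodule.finiteDimensional_of_le (S₂ := W) fun r hr => ?_
  -- It suffices to see `r I ⊆ W` for each of the ideals `I`, since `r = r e`.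
  suffices hle : ⨆ I ∈ s, I ≤ W.comap (LinearMap.mulLeft 𝕜 r) by
    simpa [h] using hle hes
  refine iSup₂_le fun I hI y hy => ?_
  change r * y ∈ W
  obtain ⟨hleft, -, hmin⟩ := hs hI
  by_cases hIR : I ≤ R
  · exact Finset.le_sup (f := id) (Finset.mem_filter.2 ⟨hI, hIR⟩) (hleft r y hy)
  · have hbot : I ⊓ R = ⊥ := by
      by_contra hne
      refine hIR (inf_eq_left.1 (hmin _ (fun x z hz => ?_) inf_le_left hne))
      rw [hzero hz.2]
      exact zero_mem _
    have hmem : r * y ∈ I ⊓ R := by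
      refine ⟨hleft r y hy, ?_⟩
      change e * (r * y) = 0
      rw [← mul_assoc, hzero hr, zero_mul]
    rw [hbot, Submodule.mem_bot] at hmem
    rw [hmem]
    exact zero_mem _

theorem isSemisimpleRing_corner (he : IsIdempotentElem e) (h : ∀ x, x * e = x)
    (hsoc : leftSocle 𝕜 B = ⊤) : IsSemisimpleRing he.Corner := by
  refine .of_sSup_simples_eq_top ?_
  set T : Ideal he.Corner := sSup {m | IsSimpleModule he.Corner m} with hT
  have hval (u : he.Corner) : e * u.1 = u.1 := ((Subsemigroup.mem_corner_iff he).1 u.2).1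
  suffices hle : sSup {I : Submodule 𝕜 B | IsMinimalLeftIdeal I} ≤
      (T.restrictScalars 𝕜).comap (Corner.proj 𝕜 he h) by
    rw [Ideal.eq_top_iff_one]
    have h1 : Corner.proj 𝕜 he h e = 1 := Subtype.ext he
    exact h1 ▸ hle (leftSocle_le_sSup 𝕜 B (hsoc ▸ Submodule.mem_top))
  refine sSup_le fun L hL y hy => ?_
  obtain ⟨hleft, -, hmin⟩ := hL
  -- `J = e L`, which lies in `L` because `L` is a left ideal.
  let J : Ideal he.Corner :=
    { carrier := {u | u.1 ∈ L}
      add_mem' := fun ha hb => L.add_mem ha hb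
      zero_mem' := L.zero_mem
      smul_mem' := fun c u hu => hleft c.1 u.1 hu }
  have hyJ : Corner.proj 𝕜 he h y ∈ J := hleft e y hy
  suffices hJT : J ≤ T from hJT hyJ
  rcases eq_or_ne J ⊥ with hJ | hJ
  · exact hJ ▸ bot_le
  refine le_sSup (isSimpleModule_iff_isAtom.2 ⟨hJ, fun K hK => ?_⟩)
  by_contra hK0
  obtain ⟨j, hj, hj0⟩ := Submodule.exists_mem_ne_zero_of_ne_bot hK0
  have hjL : j.1 ∈ L := hK.le hj
  -- `B j` is a left ideal inside `L`, and it contains `e j = j ≠ 0`.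
  have hgen : LinearMap.range (LinearMap.mulRight 𝕜 j.1) = L := by
    refine hmin _ ?_ ?_ ?_
    · rintro x _ ⟨z, rfl⟩
      exact ⟨x * z, mul_assoc _ _ _⟩
    · rintro _ ⟨z, rfl⟩
      exact hleft z _ hjL
    · intro hbot
      have : j.1 ∈ LinearMap.range (LinearMap.mulRight 𝕜 j.1) := ⟨e, hval j⟩
      rw [hbot, Submodule.mem_bot] at this
      exact hj0 (Subtype.ext this)
  refine hK.not_ge fun u hu => ?_
  obtain ⟨b, hb⟩ : u.1 ∈ LinearMap.range (LinearMap.mulRight 𝕜 j.1) := hgen ▸ hu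
  have hu' : u = Corner.proj 𝕜 he h b • j := Subtype.ext (by
    change u.1 = e * b * j.1
    rw [← hval u, ← hb, mul_assoc]; rfl)
  rw [hu']
  exact K.smul_mem _ hj

end

theorem finiteDimensional_of_isSemisimpleRing {𝕜 : Type*} [RCLike 𝕜] {U B : Type*} [Ring U]
    [Algebra 𝕜 U] [IsSemisimpleRing U] [NonUnitalNormedRing B] [NormedSpace 𝕜 B]
    (φ : U →ₙₐ[𝕜] B) (hφ : Function.Injective φ) : FiniteDimensional 𝕜 U := by
  classical
  obtain ⟨n, D, d, _, _, _, ⟨ψ⟩⟩ := IsSemisimpleRing.exists_algEquiv_pi_matrix_divisionRing 𝕜 U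
  have hD (k : Fin n) : FiniteDimensional 𝕜 (D k) := by
    -- `D k` is a corner of its matrix algebra, cut out by the matrix unit at `(0, 0)`.
    let χ : D k →ₙₐ[𝕜] Π i, Matrix (Fin (d i)) (Fin (d i)) (D i) :=
      { toFun := fun x => Pi.single k (Matrix.single 0 0 x)
        map_smul' := fun c x => by
          rw [← Matrix.smul_single, Pi.single_smul]; rfl
        map_zero' := by rw [Matrix.single_zero, Pi.single_zero]
        map_add' := fun x y => by rw [Matrix.single_add, Pi.single_add]
        map_mul' := fun x y => by rw [← Pi.single_mul, Matrix.single_mul_single_same] }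
    have hχ : Function.Injective χ := fun x y hxy =>
      by simpa using congrFun₂ (Pi.single_injective k hxy) 0 0
    exact finiteDimensional_of_divisionRing
      ((φ.comp (ψ.symm : (Π i, Matrix (Fin (d i)) (Fin (d i)) (D i)) →ₙₐ[𝕜] U)).comp χ)
      (hφ.comp (ψ.symm.injective.comp hχ))
  exact Module.Finite.equiv ψ.symm.toLinearEquiv

theorem finiteDimensional_of_leftSocle_eq_top {𝕜 : Type*} [RCLike 𝕜] {B : Type*}
    [NonUnitalNormedRing B] [NormedSpace 𝕜 B] [IsScalarTower 𝕜 B B] [SMulCommClass 𝕜 B B] {e : B}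
    (h : ∀ x, x * e = x) (hsoc : leftSocle 𝕜 B = ⊤) : FiniteDimensional 𝕜 B := by
  have he : IsIdempotentElem e := h e
  have := isSemisimpleRing_corner he h hsoc
  have : FiniteDimensional 𝕜 he.Corner :=
    finiteDimensional_of_isSemisimpleRing (IsIdempotentElem.Corner.incl 𝕜 he) Subtype.val_injective
  have hker : LinearMap.ker (IsIdempotentElem.Corner.proj 𝕜 he h) =
      LinearMap.ker (LinearMap.mulLeft 𝕜 e) := by
    ext x
    exact Subtype.ext_iff
  have : FiniteDimensional 𝕜 (LinearMap.ker (IsIdempotentElem.Corner.proj 𝕜 he h)) :=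
    hker ▸ finiteDimensional_ker_mulLeft h hsoc
  have := Module.Finite.equiv (IsIdempotentElem.Corner.proj 𝕜 he h).quotKerEquivRange.symm
  exact Module.Finite.of_submodule_quotient (LinearMap.ker (IsIdempotentElem.Corner.proj 𝕜 he h))

/-! ### The bidual -/

/-- A weak-* cluster point `E` of a bounded approximate identity is a right identity for the first
Arens product: `⟨E f, a⟩ = ⟨E, f a⟩ = lim f (a e) = f a`, so `E f = f` for every functional `f`. -/
theorem Bidual.exists_forall_mul_eq {𝕜 : Type*} [RCLike 𝕜] {A : Type*} [NonUnitalNormedRing A]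
    [NormedSpace 𝕜 A] [IsScalarTower 𝕜 A A] [SMulCommClass 𝕜 A A]
    (hA : HasBoundedApproximateIdentity A) : ∃ E : Bidual 𝕜 A, ∀ F, F * E = F := by
  obtain ⟨l, hl, C, hC⟩ := hA
  have := hl.neBot
  let 𝒰 := Ultrafilter.of l
  have hle : (𝒰 : Filter A) ≤ l := Ultrafilter.of_le l
  let ι : A → WeakDual 𝕜 (StrongDual 𝕜 A) := fun a =>
    StrongDual.toWeakDual (NormedSpace.inclusionInDoubleDual 𝕜 A a)
  obtain ⟨E, -, hE⟩ := (WeakDual.isCompact_closedBall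
    (0 : StrongDual 𝕜 (StrongDual 𝕜 A)) C).ultrafilter_le_nhds (𝒰.map ι) (by
      have hC' : ∀ᶠ e in (𝒰 : Filter A), ‖e‖ ≤ C := hle hC
      refine le_principal_iff.2 (show ∀ᶠ e in (𝒰 : Filter A), ι e ∈ _ from hC'.mono fun e he => ?_)
      simpa [ι] using (NormedSpace.double_dual_bound 𝕜 A e).trans he)
  have hlim (f : StrongDual 𝕜 A) : Tendsto (fun e => f e) 𝒰 (𝓝 (E f)) :=
    (WeakDual.eval_continuous f).continuousAt.tendsto.comp (show Tendsto ι 𝒰 (𝓝 E) from hE)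
  let E' : Bidual 𝕜 A := WeakDual.toStrongDual E
  refine ⟨E', fun F => Bidual.ext_toFunctional fun f => ?_⟩
  rw [Bidual.mul_toFunctional_apply]
  congr 1
  ext a
  exact tendsto_nhds_unique (hlim (dualAct 𝕜 A f a))
    ((f.continuous.tendsto a).comp ((hl.tendsto_mul_left a).mono_left hle))

theorem theorem1 {𝕜 : Type*} [RCLike 𝕜] {A : Type*} [NonUnitalNormedRing A] [NormedSpace 𝕜 A]
    [IsScalarTower 𝕜 A A] [SMulCommClass 𝕜 A A] [CompleteSpace A]
    (hA : HasBoundedApproximateIdentity A) (hsoc : leftSocle 𝕜 (Bidual 𝕜 A) = ⊤) :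
    FiniteDimensional 𝕜 A := by
  obtain ⟨E, hE⟩ := Bidual.exists_forall_mul_eq (𝕜 := 𝕜) hA
  have : FiniteDimensional 𝕜 (Bidual 𝕜 A) := finiteDimensional_of_leftSocle_eq_top hE hsoc
  let ι : A →ₗ[𝕜] Bidual 𝕜 A := (NormedSpace.inclusionInDoubleDual 𝕜 A).toLinearMap
  exact FiniteDimensional.of_injective ι (NormedSpace.inclusionInDoubleDualLi 𝕜 (E := A)).injective
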